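/- A Mealy automaton consists of finite sets $A$ (alphabet) and $Q$ (states) and maps $\lambda\colon Q\times A\to A$ (output) and $\rho\colon Q\times A\to Q$ (transition). It is bireversible if for every $q\in Q$ the map $a\mapsto\lambda(q,a)$ is a bijection of $A$, for every $a\in A$ the map $q\mapsto\rho(q,a)$ is a bijection of $Q$, and $(q,a)\mapsto(\lambda(q,a),\rho(q,a))$ is a bijection $Q\times A\to A\times Q$. Each state $q$ then acts bijectively on the set $A^*$ of finite words by $\lambda_q(\emptyset)=\emptyset$ and $\lambda_q(aw)=\lambda(q,a)\,\lambda_{\rho(q,a)}(w)$, which yields a homomorphism from the free group $F_Q$ to $\mathrm{Sym}(A^*)$. The quotient of $F_Q$ by the kernel of this homomorphism is the group generated by the automaton. A group is bireversible if it is isomorphic to the group generated by some bireversible automaton. For a connected, locally finite, simple undirected graph $X$, the group $\mathrm{Aut}(X)$ carries the topology of pointwise convergence on the discrete set of vertices. A topological group $\Gamma$ is compact-by-discrete if it has a compact normal subgroup $N$ such that $\Gamma/N$, with the quotient topology, is discrete. For a subgroup $H\leq\Gamma$, the commensurator $\mathrm{Comm}_\Gamma(H)$ is the subgroup of all $g\in\Gamma$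 such that $H\cap gHg^{-1}$ has finite index in both $H$ and $gHg^{-1}$. An action on $X$ by automorphisms is geometric if it is properly discontinuous (for each finite set $S$ of vertices, $gS\cap S\neq\emptyset$ for only finitely many $g$) and cocompact (the translates of some finite subgraph cover $X$). **Theorem.** Let $G$ be an infinite bireversible group. Then there exists a connected, locally finite graph $X$ on which $G$ acts faithfully and geometrically (so that $G$ is identified with a subgroup of $\mathrm{Aut}(X)$) such that, for some vertex $x$ of $X$, the group $\mathrm{Comm}_{\mathrm{Aut}(X)}(G)\cap\mathrm{Aut}_x(X)$, where $\mathrm{Aut}_x(X)$ is the stabiliser of $x$ in $\mathrm{Aut}(X)$, contains a finitely generated subgroup that is not discrete (in the subspace topology), and such that moreover $\mathrm{Aut}(X)$ is not compact-by-discrete. -/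

import Mathlib

/-- A Mealy automaton with alphabet `A` and state set `Q` (both are required to be finite where
automata are used): an output map `Q × A → A` and a transition map `Q × A → Q`. -/
structure MealyAutomaton (A Q : Type*) where
  /-- the output map -/
  out : Q → A → A
  /-- the transition map -/
  trans : Q → A → Q

namespace MealyAutomaton

/-- Invertible: every state induces a bijection of the alphabet. -/
def IsInvertible {A Q : Type*} (M : MealyAutomaton A Q) : Prop :=
  ∀ q : Q, Function.Bijective (fun a : A => M.out q a)

/-- Reversible: every letter induces a bijection of the state set. -/
def IsReversible {A Q : Type*} (M : MealyAutomaton A Q) : Prop :=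
  ∀ a : A, Function.Bijective (fun q : Q => M.trans q a)

/-- Bireversible: invertible, reversible, and the map
`(q, a) ↦ (out q a, trans q a)` is a bijection `Q × A → A × Q`. -/
def IsBireversible {A Q : Type*} (M : MealyAutomaton A Q) : Prop :=
  M.IsInvertible ∧ M.IsReversible ∧
    Function.Bijective (fun p : Q × A => (M.out p.1 p.2, M.trans p.1 p.2))

/-- The extension of the output map of a state to finite words over the alphabet,
the first letter of the list being the letter that is read first. -/
def wordMap {A Q : Type*} (M : MealyAutomaton A Q) : Q → List A → List A
  | _, [] => []
  | q, a :: w => M.out q a :: M.wordMap (M.trans q a) w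

theorem wordMap_bijective {A Q : Type*} (M : MealyAutomaton A Q) (hM : M.IsInvertible) (q : Q) :
    Function.Bijective (M.wordMap q) := by
  constructor
  · intro v
    induction v generalizing q with
    | nil =>
      intro w h
      cases w with
      | nil => rfl
      | cons b w => simp [wordMap] at h
    | cons a v ih =>
      intro w h
      cases w with
      | nil => simp [wordMap] at h
      | cons b w =>
        simp only [wordMap, List.cons.injEq] at h
        obtain ⟨h1, h2⟩ := h
        have hab : a = b := (hM q).1 h1
        subst hab
        rw [ih _ h2]
  · intro w
    induction w generalizing q with
    | nil => exact ⟨[], rfl⟩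
    | cons b w ih =>
      obtain ⟨a, ha⟩ := (hM q).2 b
      obtain ⟨v, hv⟩ := ih (M.trans q a)
      have ha' : M.out q a = b := ha
      exact ⟨a :: v, by simp only [wordMap, ha', hv]⟩

/-- The homomorphism from the free group on the states to the group of bijections of the set of
finite words (with composition from right to left) of an invertible automaton. -/
noncomputable def freeGroupHom {A Q : Type*} (M : MealyAutomaton A Q) (hM : M.IsInvertible) :
    FreeGroup Q →* Equiv.Perm (List A) :=
  FreeGroup.lift fun q => Equiv.ofBijective (M.wordMap q) (M.wordMap_bijective hM q)

/-- The group generated by an invertible Mealy automaton. -/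
abbrev generatedGroup {A Q : Type*} (M : MealyAutomaton A Q) (hM : M.IsInvertible) : Type _ :=
  FreeGroup Q ⧸ (M.freeGroupHom hM).ker

end MealyAutomaton

/-- A group is bireversible if it is isomorphic to the group generated by some (finite)
bireversible Mealy automaton. The finite sets `A` and `Q` may be taken in the lowest universe,
as every finite type is in bijection with some `Fin n`. -/
def IsBireversibleGroup (G : Type*) [Group G] : Prop :=
  ∃ (A Q : Type) (_ : Finite A) (_ : Finite Q) (M : MealyAutomaton A Q) (hM : M.IsBireversible),
    Nonempty (G ≃* M.generatedGroup hM.1)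

/-- The topology of the automorphism group of a graph: pointwise convergence on the discrete
vertex set, so that the pointwise stabilisers of finite sets of vertices form a basis of
neighbourhoods of the identity. -/
instance graphAutTopology {V : Type*} (X : SimpleGraph V) : TopologicalSpace (X ≃g X) :=
  TopologicalSpace.induced (fun f : X ≃g X => (f : V → V))
    (@Pi.topologicalSpace V (fun _ => V) (fun _ => ⊥))

/-- A topological group is compact-by-discrete if it has a compact normal subgroup whose quotient
is discrete for the quotient topology. -/
def IsCompactByDiscrete (Γ : Type*) [Group Γ] [TopologicalSpace Γ] : Prop :=
  ∃ N : Subgroup Γ, N.Normal ∧ IsCompact (N : Set Γ) ∧ DiscreteTopology (Γ ⧸ N)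

/-- An action of `G` by automorphisms on a locally finite graph is geometric if it is
properly discontinuous (for each finite set `S` of vertices, only finitely many `g` satisfy
`gS ∩ S ≠ ∅`) and cocompact (the translates of some finite subgraph cover all the vertices and
all the edges). For a locally finite graph, this is the same as a properly discontinuous and
cocompact action on the associated 1-dimensional complex, because compact subsets of the latter
are the closed subsets of finite subcomplexes. -/
structure IsGeometricAction {G V : Type*} [Group G] (X : SimpleGraph V) (φ : G →* (X ≃g X)) :
    Prop where
  proper : ∀ S : Set V, S.Finite → {g : G | ((φ g '' S) ∩ S).Nonempty}.Finite
  cocompact : ∃ Y : X.Subgraph, Y.verts.Finite ∧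
    (∀ v : V, ∃ g : G, ∃ w ∈ Y.verts, φ g w = v) ∧
    (∀ u v : V, X.Adj u v → ∃ (g : G) (u' v' : V), Y.Adj u' v' ∧ φ g u' = u ∧ φ g v' = v)

/-!
Let `G` be the group generated by a bireversible automaton, acting on words on the left, and let
`X` be its Cayley graph with `u` joined to `q u` for every state `q`. The group `G` acts on `X` by
right multiplication, simply transitively on the vertices, hence geometrically.

Every `g` in `G` has a section `g|_a` at every letter `a`, defined by `g (a w) = g(a) (g|_a) (w)`.
By the cocycle identity `(g h)|_a = g|_{h(a)} h|_a`, taking sections at `a` fixes the identity and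
maps the edge from `h` to `q h` to the edge from `h|_a` to `q' h|_a` with `q' = q|_{h(a)}` again a
state. Bireversibility allows to lift words in the states and their inverses letter by letter, so
each ball around the identity is mapped onto itself; as balls are finite, taking sections at `a` is
a bijection (`MealyAutomaton.sec_bijective`) and so an automorphism `σ_a` of `X`
(`MealyAutomaton.secIso`). By the cocycle identity once more, `σ_a` conjugates right multiplication
by an element `g` of the stabiliser of the letter `a` to right multiplication by `g|_a`. The
stabiliser and its image both have finite index in `G`, whence `σ_a` commensurates `G`
(`MealyAutomaton.secIso_mem_commensurator`).

Let `K` be the group generated by the finitely many `σ_a`; it fixes the vertex `1`. If the orbits of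
`K` on `X` had at most `C` elements, every `g` in `G` would have at most `C` iterated sections, and
so would be given by a state of an automaton with `C` states. There are finitely many of these, so
`G` would be finite (`MealyAutomaton.finite_of_secGroup_orbits_bounded`). If `G` is infinite,
therefore, no group of automorphisms with orbits of bounded size contains the pointwise stabiliser
in `K` of a finite set (`MealyAutomaton.finite_of_fixing_subset`). For the trivial group this says
that `K` is not discrete. If `Aut X` were compact-by-discrete, a compact open normal subgroup would contain such a
stabiliser, and its orbits would be of bounded size: they are finite by compactness, and translates
of one another by normality and vertex-transitivity.
-/

/-! ### Topology of the automorphism group of a graph -/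

/-- Every neighbourhood of the identity contains the pointwise stabiliser of a finite set. -/
theorem exists_finite_fixing_subset_of_mem_nhds_one {V : Type*} {X : SimpleGraph V}
    {U : Set (X ≃g X)} (hU : U ∈ nhds (1 : X ≃g X)) :
    ∃ F : Set V, F.Finite ∧ ∀ k : X ≃g X, (∀ v ∈ F, k v = v) → k ∈ U := by
  let _ : TopologicalSpace V := ⊥
  have : DiscreteTopology V := ⟨rfl⟩
  rw [nhds_induced, Filter.mem_comap] at hU
  obtain ⟨W, hW, hWU⟩ := hU
  rw [nhds_pi, Filter.mem_pi] at hW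
  obtain ⟨F, hF, t, ht, htW⟩ := hW
  refine ⟨F, hF, fun k hk => hWU (htW fun v hv => ?_)⟩
  have h1 : (1 : X ≃g X) v ∈ t v := mem_of_mem_nhds (ht v)
  have h2 : k v = (1 : X ≃g X) v := hk v hv
  change k v ∈ t v
  exact h2.symm ▸ h1

/-- The orbits of a compact set of automorphisms are finite. -/
theorem finite_image_apply_of_isCompact {V : Type*} {X : SimpleGraph V} {N : Set (X ≃g X)}
    (hN : IsCompact N) (v : V) : ((fun k : X ≃g X => k v) '' N).Finite := by
  let _ : TopologicalSpace V := ⊥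
  have : DiscreteTopology V := ⟨rfl⟩
  have hc : Continuous (fun k : X ≃g X => k v) :=
    (continuous_apply v).comp continuous_induced_dom
  exact (hN.image hc).finite_of_discrete

/-- If the quotient by a subgroup is discrete, the subgroup is a neighbourhood of the identity. -/
theorem Subgroup.mem_nhds_one_of_discreteTopology_quotient {Γ : Type*} [Group Γ]
    [TopologicalSpace Γ] (N : Subgroup Γ) [DiscreteTopology (Γ ⧸ N)] :
    (N : Set Γ) ∈ nhds (1 : Γ) := by
  have hopen : IsOpen ((fun γ : Γ => (γ : Γ ⧸ N)) ⁻¹' {((1 : Γ) : Γ ⧸ N)}) :=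
    (isOpen_discrete _).preimage continuous_quotient_mk'
  refine Filter.mem_of_superset (hopen.mem_nhds rfl) fun γ hγ => ?_
  have h : ((1 : Γ) : Γ ⧸ N) = γ := hγ.symm
  simpa using QuotientGroup.eq.mp h

/-! ### Indices and commensurators -/

/-- A subgroup `L` has finite relative index in `K` if the members of `K` can be coloured with
finitely many colours so that members of the same colour lie in the same left coset of `L`. -/
theorem Subgroup.relIndex_ne_zero_of_coloring {Γ α : Type*} [Group Γ] [Finite α]
    {L K : Subgroup Γ} (c : K → α)
    (hc : ∀ k k' : K, c k = c k' → (k : Γ)⁻¹ * k' ∈ L) : L.relIndex K ≠ 0 := by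
  have hfin : Finite (K ⧸ L.subgroupOf K) := by
    refine Finite.of_injective (fun x : K ⧸ L.subgroupOf K => c x.out) fun x y hxy => ?_
    rw [← QuotientGroup.out_eq' x, ← QuotientGroup.out_eq' y, QuotientGroup.eq]
    exact hc _ _ hxy
  exact (Subgroup.finiteIndex_of_finite_quotient (H := L.subgroupOf K)).index_ne_zero

open scoped Pointwise in
/-- If `σ` conjugates the elements of `φ V` that come from the stabiliser of a point `a` into
`φ V` through a surjective crossed homomorphism `τ`, then `σ` commensurates `φ V`, provided that
the action is on a finite set. -/
theorem mem_commensurator_range_of_conj {Γ V A : Type*} [Group Γ] [Group V] [Finite A]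
    (φ : V →* Γ) (σ : Γ) (act : V → A → A) (τ : V → V) (a : A)
    (hact : ∀ g h, act g a = act h a → act (g⁻¹ * h) a = a)
    (hτ : ∀ g h, act g a = act h a → τ (g⁻¹ * h) = (τ g)⁻¹ * τ h)
    (hsurj : Function.Surjective τ)
    (hconj : ∀ g, act g a = a → σ * φ g * σ⁻¹ = φ (τ g)) :
    σ ∈ Subgroup.Commensurable.commensurator φ.range := by
  rw [Subgroup.Commensurable.commensurator_mem_iff]
  have hmem : ∀ γ, γ ∈ ConjAct.toConjAct σ • φ.range ↔ ∃ g, σ * φ g * σ⁻¹ = γ := by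
    intro γ
    simp only [Subgroup.mem_smul_pointwise_iff_exists, MonoidHom.mem_range, ConjAct.toConjAct_smul]
    constructor
    · rintro ⟨_, ⟨g, rfl⟩, h⟩
      exact ⟨g, h⟩
    · rintro ⟨g, h⟩
      exact ⟨_, ⟨g, rfl⟩, h⟩
  constructor
  · have h1 : ∀ k : φ.range, ∃ g : V, φ (τ g) = k := by
      rintro ⟨_, g, rfl⟩
      obtain ⟨g', rfl⟩ := hsurj g
      exact ⟨g', rfl⟩
    choose r hr using h1
    refine Subgroup.relIndex_ne_zero_of_coloring (fun k => act (r k) a) fun k k' h => ?_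
    rw [hmem]
    refine ⟨(r k)⁻¹ * r k', ?_⟩
    rw [hconj _ (hact _ _ h), hτ _ _ h, map_mul, map_inv, hr, hr]
  · have h1 : ∀ k : (ConjAct.toConjAct σ • φ.range : Subgroup Γ),
        ∃ g : V, σ * φ g * σ⁻¹ = k := fun k => (hmem _).1 k.2
    choose r hr using h1
    refine Subgroup.relIndex_ne_zero_of_coloring (fun k => act (r k) a) fun k k' h => ?_
    refine ⟨τ ((r k)⁻¹ * r k'), ?_⟩
    rw [← hconj _ (hact _ _ h), ← hr k, ← hr k', map_mul, map_inv]
    group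

/-! ### Cayley graphs with generators multiplying on the left -/

section Cayley

variable {V : Type*} [Group V] (s : Set V)

/-- The Cayley graph of `V` in which `u` and `t * u` are joined for all generators `t ∈ s` with
`t ≠ 1`. The group acts on it by right multiplication. -/
def leftCayley : SimpleGraph V :=
  SimpleGraph.fromRel fun u v => ∃ t ∈ s, t * u = v

theorem leftCayley_adj {u v : V} : (leftCayley s).Adj u v ↔
    u ≠ v ∧ ((∃ t ∈ s, t * u = v) ∨ ∃ t ∈ s, t * v = u) := Iff.rfl

/-- The action of `V` on its Cayley graph, the element `g` acting by `u ↦ u * g⁻¹`. -/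
def rightMulHom : V →* (leftCayley s ≃g leftCayley s) where
  toFun g :=
    { toEquiv := Equiv.mulRight g⁻¹
      map_rel_iff' := by
        intro u v
        simp [leftCayley_adj, ← mul_assoc] }
  map_one' := by
    ext u
    exact (congrArg (u * ·) inv_one).trans (mul_one u)
  map_mul' g h := by
    ext u
    change u * (g * h)⁻¹ = u * h⁻¹ * g⁻¹
    group

theorem leftCayley_reachable_mul {t : V} (ht : t ∈ s) (u : V) :
    (leftCayley s).Reachable u (t * u) := by
  by_cases h : u = t * u
  · exact h ▸ SimpleGraph.Reachable.refl u
  · exact SimpleGraph.Adj.reachable ((leftCayley_adj s).2 ⟨h, Or.inl ⟨t, ht, rfl⟩⟩)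

theorem leftCayley_connected (hs : Subgroup.closure s = ⊤) : (leftCayley s).Connected := by
  have h : ∀ u : V, (leftCayley s).Reachable 1 u := by
    intro u
    have hu : u ∈ Subgroup.closure s := hs ▸ Subgroup.mem_top u
    induction hu using Subgroup.closure_induction_left with
    | one => exact SimpleGraph.Reachable.refl _
    | mul_left t ht u _ ih => exact ih.trans (leftCayley_reachable_mul s ht u)
    | inv_mul_cancel t ht u _ ih =>
      refine ih.trans ?_
      simpa using (leftCayley_reachable_mul s ht (t⁻¹ * u)).symm
  have : Nonempty V := ⟨1⟩
  exact ⟨fun u v => (h u).symm.trans (h v)⟩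

theorem leftCayley_neighborSet_finite (hs : s.Finite) (u : V) :
    ((leftCayley s).neighborSet u).Finite := by
  refine ((hs.image (fun t => t * u)).union (hs.image (fun t => t⁻¹ * u))).subset ?_
  rintro v ⟨-, ⟨t, ht, rfl⟩ | ⟨t, ht, rfl⟩⟩
  · exact Or.inl ⟨t, ht, rfl⟩
  · exact Or.inr ⟨t, ht, by simp⟩

theorem isGeometricAction_rightMulHom (hs : s.Finite) {G : Type*} [Group G] (e : G ≃* V) :
    IsGeometricAction (leftCayley s) ((rightMulHom s).comp e.toMonoidHom) := by
  refine ⟨fun S hS => ?_, ?_⟩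
  · have hfin : (Set.image2 (fun u v : V => v⁻¹ * u) S S).Finite := hS.image2 _ hS
    refine (hfin.preimage e.injective.injOn).subset ?_
    rintro g ⟨_, ⟨u, hu, rfl⟩, hv⟩
    refine ⟨u, hu, _, hv, ?_⟩
    change (u * (e g)⁻¹)⁻¹ * u = e g
    group
  -- The closed star of the identity is a finite subgraph whose translates cover the graph.
  · refine ⟨(⊤ : (leftCayley s).Subgraph).induce (insert 1 ((leftCayley s).neighborSet 1)),
      (leftCayley_neighborSet_finite s hs 1).insert 1, fun v => ?_, fun u v huv => ?_⟩
    · refine ⟨e.symm v⁻¹, 1, Set.mem_insert _ _, ?_⟩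
      change 1 * (e (e.symm v⁻¹))⁻¹ = v
      simp
    · have hadj : (leftCayley s).Adj 1 (v * u⁻¹) := by
        have h := (rightMulHom s u).map_rel_iff'.2 huv
        change (leftCayley s).Adj (u * u⁻¹) (v * u⁻¹) at h
        rwa [mul_inv_cancel] at h
      refine ⟨e.symm u⁻¹, 1, v * u⁻¹, ⟨Set.mem_insert _ _, Or.inr hadj, hadj⟩, ?_, ?_⟩
      · change 1 * (e (e.symm u⁻¹))⁻¹ = u
        simp
      · change v * u⁻¹ * (e (e.symm u⁻¹))⁻¹ = v
        simp

end Cayley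

/-! ### Sections of automaton transformations -/

namespace MealyAutomaton

variable {A Q : Type*} (M : MealyAutomaton A Q) (hM : M.IsInvertible)

/-- The group generated by an invertible automaton, realised as a group of permutations of the
set of words. -/
noncomputable abbrev wordGroup : Subgroup (Equiv.Perm (List A)) :=
  (M.freeGroupHom hM).range

/-- The element of the group generated by the automaton that is given by a state. -/
noncomputable def state (q : Q) : M.wordGroup hM :=
  ⟨M.freeGroupHom hM (FreeGroup.of q), ⟨_, rfl⟩⟩

theorem state_apply (q : Q) (w : List A) :
    (M.state hM q : Equiv.Perm (List A)) w = M.wordMap q w := by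
  simp [state, freeGroupHom]

theorem closure_range_state : Subgroup.closure (Set.range (M.state hM)) = ⊤ := by
  apply Subgroup.map_injective (M.wordGroup hM).subtype_injective
  rw [MonoidHom.map_closure, ← Set.range_comp, ← MonoidHom.range_eq_map, Subgroup.range_subtype]
  have h : ((M.wordGroup hM).subtype ∘ M.state hM) =
      fun q => Equiv.ofBijective (M.wordMap q) (M.wordMap_bijective hM q) := by
    funext q
    ext1 w
    exact M.state_apply hM q w
  rw [h, wordGroup, freeGroupHom, FreeGroup.range_lift_eq_closure]

/-- The elements of the group generated by the automaton fix the empty word, and each of them acts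
on the words with a given first letter by changing this letter and transforming the remaining word
by another element of the group. -/
theorem exists_section (g : M.wordGroup hM) :
    (g : Equiv.Perm (List A)) [] = [] ∧ ∀ a : A, ∃ (b : A) (h : M.wordGroup hM),
      ∀ w, (g : Equiv.Perm (List A)) (a :: w) = b :: (h : Equiv.Perm (List A)) w := by
  have hg : g ∈ Subgroup.closure (Set.range (M.state hM)) :=
    M.closure_range_state hM ▸ Subgroup.mem_top g
  induction hg using Subgroup.closure_induction with
  | mem g hg =>
    obtain ⟨q, rfl⟩ := hg
    refine ⟨M.state_apply hM q [], fun a => ⟨M.out q a, M.state hM (M.trans q a), fun w => ?_⟩⟩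
    simp only [state_apply, wordMap]
  | one => exact ⟨rfl, fun a => ⟨a, 1, fun _ => rfl⟩⟩
  | mul g g' _ _ hg hg' =>
    refine ⟨by simp [hg.1, hg'.1], fun a => ?_⟩
    obtain ⟨b, h, hh⟩ := hg'.2 a
    obtain ⟨c, h', hh'⟩ := hg.2 b
    exact ⟨c, h' * h, fun w => by simp [hh, hh']⟩
  | inv g _ hg =>
    have hnil : (g⁻¹ : Equiv.Perm (List A)) [] = [] := by
      rw [Equiv.Perm.inv_eq_iff_eq, hg.1]
    refine ⟨by simpa using hnil, fun a => ?_⟩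
    -- The new first letter is found by applying `g⁻¹` to the one-letter word `[a]`.
    obtain hw | ⟨c, u, hw⟩ : (g⁻¹ : Equiv.Perm (List A)) [a] = [] ∨
        ∃ c u, (g⁻¹ : Equiv.Perm (List A)) [a] = c :: u := by
      cases (g⁻¹ : Equiv.Perm (List A)) [a] with
      | nil => exact Or.inl rfl
      | cons c u => exact Or.inr ⟨c, u, rfl⟩
    · rw [Equiv.Perm.inv_eq_iff_eq, hg.1] at hw
      simp at hw
    · obtain ⟨b, h, hh⟩ := hg.2 c
      rw [Equiv.Perm.inv_eq_iff_eq, hh] at hw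
      obtain ⟨rfl, -⟩ := List.cons.inj hw
      refine ⟨c, h⁻¹, fun w => ?_⟩
      rw [Subgroup.coe_inv, Equiv.Perm.inv_eq_iff_eq, hh]
      simp

/-- The image of a letter under an element of the group generated by the automaton. -/
noncomputable def act (g : M.wordGroup hM) (a : A) : A :=
  ((M.exists_section hM g).2 a).choose

/-- The section of an element `g` of the group generated by the automaton at a letter `a`: the
element that describes the action of `g` on the remainder of a word with first letter `a`. -/
noncomputable def sec (g : M.wordGroup hM) (a : A) : M.wordGroup hM :=
  ((M.exists_section hM g).2 a).choose_spec.choose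

theorem apply_nil (g : M.wordGroup hM) : (g : Equiv.Perm (List A)) [] = [] :=
  (M.exists_section hM g).1

theorem apply_cons (g : M.wordGroup hM) (a : A) (w : List A) :
    (g : Equiv.Perm (List A)) (a :: w) =
      M.act hM g a :: (M.sec hM g a : Equiv.Perm (List A)) w :=
  ((M.exists_section hM g).2 a).choose_spec.choose_spec w

theorem act_sec_unique {g h : M.wordGroup hM} {a b : A}
    (H : ∀ w, (g : Equiv.Perm (List A)) (a :: w) = b :: (h : Equiv.Perm (List A)) w) :
    M.act hM g a = b ∧ M.sec hM g a = h := by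
  simp only [apply_cons, List.cons.injEq] at H
  refine ⟨(H []).1, Subtype.ext (Equiv.ext fun w => (H w).2)⟩

theorem act_one (a : A) : M.act hM 1 a = a :=
  (M.act_sec_unique hM (g := 1) (h := 1) fun _ => rfl).1

theorem sec_one (a : A) : M.sec hM 1 a = 1 :=
  (M.act_sec_unique hM (g := 1) (h := 1) fun _ => rfl).2

theorem act_sec_mul (g h : M.wordGroup hM) (a : A) :
    M.act hM (g * h) a = M.act hM g (M.act hM h a) ∧
      M.sec hM (g * h) a = M.sec hM g (M.act hM h a) * M.sec hM h a :=
  M.act_sec_unique hM fun w => by simp [apply_cons]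

theorem act_mul (g h : M.wordGroup hM) (a : A) :
    M.act hM (g * h) a = M.act hM g (M.act hM h a) := (M.act_sec_mul hM g h a).1

theorem sec_mul (g h : M.wordGroup hM) (a : A) :
    M.sec hM (g * h) a = M.sec hM g (M.act hM h a) * M.sec hM h a := (M.act_sec_mul hM g h a).2

theorem act_state (q : Q) (a : A) : M.act hM (M.state hM q) a = M.out q a :=
  (M.act_sec_unique hM (h := M.state hM (M.trans q a)) fun w => by
    simp only [state_apply, wordMap]).1

theorem sec_state (q : Q) (a : A) : M.sec hM (M.state hM q) a = M.state hM (M.trans q a) :=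
  (M.act_sec_unique hM (b := M.out q a) fun w => by simp only [state_apply, wordMap]).2

theorem act_inv_act (g : M.wordGroup hM) (a : A) : M.act hM g⁻¹ (M.act hM g a) = a := by
  rw [← act_mul, inv_mul_cancel, act_one]

theorem sec_inv_act (g : M.wordGroup hM) (a : A) :
    M.sec hM g⁻¹ (M.act hM g a) = (M.sec hM g a)⁻¹ := by
  rw [eq_inv_iff_mul_eq_one, ← sec_mul, inv_mul_cancel, sec_one]

/-! ### Taking sections permutes the group of a bireversible automaton -/

/-- The generators given by the states, their inverses, and the identity. -/
def gens : Set (M.wordGroup hM) :=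
  {1} ∪ (Set.range (M.state hM) ∪ (Set.range (M.state hM))⁻¹)

theorem one_mem_gens : 1 ∈ M.gens hM := Or.inl rfl

theorem gens_finite [Finite Q] : (M.gens hM).Finite :=
  (Set.finite_singleton _).union ((Set.finite_range _).union (Set.finite_range _).inv)

theorem sec_mem_gens {t : M.wordGroup hM} (ht : t ∈ M.gens hM) (a : A) :
    M.sec hM t a ∈ M.gens hM := by
  obtain rfl | ⟨q, rfl⟩ | ⟨q, hq⟩ := ht
  · exact Or.inl (M.sec_one hM a)
  · exact Or.inr (Or.inl ⟨M.trans q a, (M.sec_state hM q a).symm⟩)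
  · obtain rfl : t = (M.state hM q)⁻¹ := by rw [hq, inv_inv]
    obtain ⟨c, hc⟩ := (hM q).2 a
    have hc' : M.act hM (M.state hM q) c = a := (M.act_state hM q c).trans hc
    refine Or.inr (Or.inr ⟨M.trans q c, ?_⟩)
    rw [← hc', sec_inv_act, inv_inv, sec_state]

/-- Reversibility provides the states with a given section at `a`, and the bijectivity of
`(q, a) ↦ (out q a, trans q a)` the inverses of states with a given section at `a`. -/
theorem exists_mem_gens_sec_eq (hB : M.IsBireversible) {t : M.wordGroup hM}
    (ht : t ∈ M.gens hM) (a : A) : ∃ t' ∈ M.gens hM, M.sec hM t' a = t := by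
  obtain rfl | ⟨p, rfl⟩ | ⟨p, hp⟩ := ht
  · exact ⟨1, M.one_mem_gens hM, M.sec_one hM a⟩
  · obtain ⟨q, hq⟩ := (hB.2.1 a).2 p
    refine ⟨M.state hM q, Or.inr (Or.inl ⟨q, rfl⟩), ?_⟩
    rw [sec_state]
    exact congrArg _ hq
  · obtain rfl : t = (M.state hM p)⁻¹ := by rw [hp, inv_inv]
    obtain ⟨⟨q, c⟩, hqc⟩ := hB.2.2.2 (a, p)
    obtain ⟨h1, h2⟩ := Prod.mk.inj hqc
    have h1' : M.act hM (M.state hM q) c = a := (M.act_state hM q c).trans h1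
    refine ⟨(M.state hM q)⁻¹, Or.inr (Or.inr ⟨q, (inv_inv _).symm⟩), ?_⟩
    rw [← h1', sec_inv_act, sec_state]
    exact congrArg (fun r => (M.state hM r)⁻¹) h2

open scoped Pointwise

theorem gens_pow_finite [Finite Q] (n : ℕ) : (M.gens hM ^ n).Finite := by
  induction n with
  | zero => exact Set.finite_one
  | succ n ih =>
    rw [pow_succ']
    exact (M.gens_finite hM).mul ih

theorem exists_mem_gens_pow (g : M.wordGroup hM) : ∃ n : ℕ, g ∈ M.gens hM ^ n := by
  have hg : g ∈ Subgroup.closure (Set.range (M.state hM)) :=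
    M.closure_range_state hM ▸ Subgroup.mem_top g
  induction hg using Subgroup.closure_induction_left with
  | one => exact ⟨0, Set.one_mem_one⟩
  | mul_left t ht g _ ih =>
    obtain ⟨n, hn⟩ := ih
    exact ⟨n + 1, pow_succ' (M.gens hM) n ▸ Set.mul_mem_mul (Or.inr (Or.inl ht)) hn⟩
  | inv_mul_cancel t ht g _ ih =>
    obtain ⟨n, hn⟩ := ih
    refine ⟨n + 1, pow_succ' (M.gens hM) n ▸ Set.mul_mem_mul (Or.inr (Or.inr ?_)) hn⟩
    simpa using ht

theorem sec_mem_gens_pow (n : ℕ) {g : M.wordGroup hM} (hg : g ∈ M.gens hM ^ n) (a : A) :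
    M.sec hM g a ∈ M.gens hM ^ n := by
  induction n generalizing g a with
  | zero =>
    obtain rfl : g = 1 := by simpa using hg
    rw [sec_one]
    exact Set.one_mem_one
  | succ n ih =>
    rw [pow_succ'] at hg ⊢
    obtain ⟨t, ht, h, hh, rfl⟩ := hg
    change M.sec hM (t * h) a ∈ _
    rw [sec_mul]
    exact Set.mul_mem_mul (M.sec_mem_gens hM ht _) (ih hh a)

theorem surjOn_sec_gens_pow (hB : M.IsBireversible) (n : ℕ) (a : A) :
    Set.SurjOn (fun g => M.sec hM g a) (M.gens hM ^ n) (M.gens hM ^ n) := by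
  induction n with
  | zero =>
    intro g hg
    obtain rfl : g = 1 := by simpa using hg
    exact ⟨1, Set.one_mem_one, M.sec_one hM a⟩
  | succ n ih =>
    intro g hg
    rw [pow_succ'] at hg ⊢
    obtain ⟨t, ht, h, hh, rfl⟩ := hg
    obtain ⟨h', hh', rfl⟩ := ih hh
    obtain ⟨t', ht', rfl⟩ := M.exists_mem_gens_sec_eq hM hB ht (M.act hM h' a)
    exact ⟨t' * h', Set.mul_mem_mul ht' hh', M.sec_mul hM t' h' a⟩

/-- On each ball of the word metric, taking sections at `a` is a surjection of a finite set to
itself, hence a bijection. -/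
theorem sec_bijective [Finite Q] (hB : M.IsBireversible) (a : A) :
    Function.Bijective (fun g => M.sec hM g a) := by
  constructor
  · intro g h hgh
    obtain ⟨m, hm⟩ := M.exists_mem_gens_pow hM g
    obtain ⟨n, hn⟩ := M.exists_mem_gens_pow hM h
    have hfin : (M.gens hM ^ max m n).Finite := M.gens_pow_finite hM _
    have himg : (fun g => M.sec hM g a) '' (M.gens hM ^ max m n) = M.gens hM ^ max m n :=
      Set.Subset.antisymm (Set.image_subset_iff.2 fun g hg => M.sec_mem_gens_pow hM _ hg a)
        (M.surjOn_sec_gens_pow hM hB _ a)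
    have hinj := hfin.injOn_of_encard_image_eq (congrArg Set.encard himg)
    exact hinj (Set.pow_subset_pow_right (M.one_mem_gens hM) (le_max_left m n) hm)
      (Set.pow_subset_pow_right (M.one_mem_gens hM) (le_max_right m n) hn) hgh
  · intro g
    obtain ⟨n, hn⟩ := M.exists_mem_gens_pow hM g
    obtain ⟨h, -, hh⟩ := M.surjOn_sec_gens_pow hM hB n a hn
    exact ⟨h, hh⟩

/-! ### Sections as automorphisms of the Cayley graph -/

/-- The Cayley graph of the group generated by the automaton with respect to the states. -/
noncomputable abbrev stateGraph : SimpleGraph (M.wordGroup hM) :=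
  leftCayley (Set.range (M.state hM))

/-- For a bireversible automaton, taking the section at a letter is an automorphism of the Cayley
graph: the section of `t * h` at `a` is the section of `t` at the image of `a` under `h`, times
the section of `h` at `a`. -/
noncomputable def secIso [Finite Q] (hB : M.IsBireversible) (a : A) :
    M.stateGraph hM ≃g M.stateGraph hM where
  toEquiv := Equiv.ofBijective (fun g => M.sec hM g a) (M.sec_bijective hM hB a)
  map_rel_iff' := by
    have key : ∀ u v : M.wordGroup hM,
        (∃ t ∈ Set.range (M.state hM), t * M.sec hM u a = M.sec hM v a) ↔
          ∃ t ∈ Set.range (M.state hM), t * u = v := by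
      intro u v
      constructor
      · rintro ⟨_, ⟨p, rfl⟩, h⟩
        obtain ⟨q, hq⟩ := (hB.2.1 (M.act hM u a)).2 p
        refine ⟨_, ⟨q, rfl⟩, (M.sec_bijective hM hB a).1 ?_⟩
        change M.sec hM (M.state hM q * u) a = M.sec hM v a
        rw [sec_mul, sec_state, ← h]
        exact congrArg (fun r => M.state hM r * M.sec hM u a) hq
      · rintro ⟨_, ⟨q, rfl⟩, rfl⟩
        exact ⟨_, ⟨M.trans q (M.act hM u a), rfl⟩, by rw [sec_mul, sec_state]⟩
    intro u v
    change (leftCayley _).Adj (M.sec hM u a) (M.sec hM v a) ↔ _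
    rw [leftCayley_adj, leftCayley_adj, key, key, (M.sec_bijective hM hB a).1.ne_iff]

/-- The automorphism `secIso a` conjugates the right multiplication by an element `g` that fixes
the letter `a` to the right multiplication by the section of `g` at `a`. -/
theorem secIso_mem_commensurator [Finite A] [Finite Q] (hB : M.IsBireversible) (a : A) :
    M.secIso hM hB a ∈
      Subgroup.Commensurable.commensurator (rightMulHom (Set.range (M.state hM))).range := by
  refine mem_commensurator_range_of_conj _ _ (M.act hM) (fun g => M.sec hM g a) a
    (fun g h hgh => ?_) (fun g h hgh => ?_) (M.sec_bijective hM hB a).2 (fun g hg => ?_)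
  · rw [act_mul, ← hgh, act_inv_act]
  · change M.sec hM (g⁻¹ * h) a = _
    rw [sec_mul, ← hgh, sec_inv_act]
  · rw [mul_inv_eq_iff_eq_mul]
    ext1 u
    change M.sec hM (u * g⁻¹) a = M.sec hM u a * (M.sec hM g a)⁻¹
    have hg' : M.act hM g⁻¹ a = a := by
      conv_lhs => rw [← hg]
      exact M.act_inv_act hM g a
    have hs := M.sec_inv_act hM g a
    rw [hg] at hs
    rw [sec_mul, hg', hs]

/-- The group of automorphisms of the Cayley graph generated by the sections at letters. -/
noncomputable def secGroup [Finite Q] (hB : M.IsBireversible) :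
    Subgroup (M.stateGraph hM ≃g M.stateGraph hM) :=
  Subgroup.closure (Set.range (M.secIso hM hB))

/-- The group generated by the sections preserves the balls around the identity. -/
theorem secGroup_apply_mem_gens_pow [Finite Q] (hB : M.IsBireversible)
    {k : M.stateGraph hM ≃g M.stateGraph hM} (hk : k ∈ M.secGroup hM hB) (n : ℕ)
    {g : M.wordGroup hM} (hg : g ∈ M.gens hM ^ n) : k g ∈ M.gens hM ^ n := by
  induction hk using Subgroup.closure_induction generalizing g with
  | mem k hk =>
    obtain ⟨a, rfl⟩ := hk
    exact M.sec_mem_gens_pow hM n hg a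
  | one => exact hg
  | mul k l _ _ ihk ihl => exact ihk (ihl hg)
  | inv k _ ih =>
    -- A finite set that is mapped into itself by a bijection is preserved by the inverse.
    have hfin : (M.gens hM ^ n).Finite := M.gens_pow_finite hM n
    have himg : k '' (M.gens hM ^ n) = M.gens hM ^ n :=
      hfin.eq_of_subset_of_encard_le' (Set.image_subset_iff.2 fun g hg => ih hg)
        (k.injective.encard_image _).ge
    obtain ⟨h, hh, rfl⟩ := himg.symm ▸ hg
    rwa [RelIso.inv_apply_self]

/-! ### Boundedly many sections force finiteness -/

/-- If every element has at most `C` images under the group generated by the sections, every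
element is given by a state of an automaton with `C` states, and there are only finitely many
such automata. -/
theorem finite_of_secGroup_orbits_bounded [Finite A] [Finite Q] (hB : M.IsBireversible) (C : ℕ)
    (hC : ∀ g : M.wordGroup hM, ∃ T : Set (M.wordGroup hM), T.Finite ∧ T.ncard ≤ C ∧
      ∀ k ∈ M.secGroup hM hB, k g ∈ T) : Finite (M.wordGroup hM) := by
  let F : (Fin C → A → A) × (Fin C → A → Fin C) × Fin C → List A → List A :=
    fun p => MealyAutomaton.wordMap ⟨p.1, p.2.1⟩ p.2.2
  have hF : ∀ g : M.wordGroup hM, ∃ p, F p = (g : Equiv.Perm (List A)) := by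
    intro g
    obtain ⟨T, hT, hTC, hgT⟩ := hC g
    let S : Set (M.wordGroup hM) := {h | ∃ k ∈ M.secGroup hM hB, k g = h}
    have hST : S ⊆ T := by
      rintro _ ⟨k, hk, rfl⟩
      exact hgT k hk
    have hgS : g ∈ S := ⟨1, one_mem _, rfl⟩
    have hSsec : ∀ h ∈ S, ∀ a, M.sec hM h a ∈ S := by
      rintro _ ⟨k, hk, rfl⟩ a
      exact ⟨M.secIso hM hB a * k, mul_mem (Subgroup.subset_closure ⟨a, rfl⟩) hk, rfl⟩
    have hSfin : Finite S := hT.subset hST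
    have hcard : Nat.card S ≤ Nat.card (Fin C) := by
      rw [Nat.card_fin]
      exact (Set.ncard_le_ncard hST hT).trans hTC
    obtain ⟨i⟩ : Nonempty (S ↪ Fin C) := by
      have := Fintype.ofFinite S
      refine Function.Embedding.nonempty_of_card_le ?_
      simpa [Nat.card_eq_fintype_card] using hcard
    have : Nonempty S := ⟨⟨g, hgS⟩⟩
    let e : Fin C → S := Function.invFun i
    have he : ∀ h, e (i h) = h := Function.leftInverse_invFun i.injective
    let p : (Fin C → A → A) × (Fin C → A → Fin C) × Fin C :=
      ⟨fun j a => M.act hM (e j) a, fun j a => i ⟨M.sec hM (e j) a, hSsec _ (e j).2 a⟩,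
        i ⟨g, hgS⟩⟩
    have key : ∀ (w : List A) (j : Fin C), MealyAutomaton.wordMap ⟨p.1, p.2.1⟩ j w =
        ((e j : M.wordGroup hM) : Equiv.Perm (List A)) w := by
      intro w
      induction w with
      | nil => exact fun j => (M.apply_nil hM _).symm
      | cons a w ih =>
        intro j
        rw [wordMap, ih, apply_cons]
        simp only [p, he]
    refine ⟨p, funext fun w => ?_⟩
    refine (key w _).trans ?_
    simp only [p, he]
  choose r hr using hF
  refine Finite.of_injective r fun g h hgh => Subtype.ext (DFunLike.coe_injective ?_)
  rw [← hr g, ← hr h, hgh]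

/-- If a set `N` of automorphisms with orbits of bounded size contains the pointwise stabiliser of a
finite set in the group generated by the sections, then the group generated by the automaton is
finite: this stabiliser contains the finite-index subgroup that fixes a ball pointwise, so that the
orbits under the group generated by the sections are of bounded size as well. -/
theorem finite_of_fixing_subset [Finite A] [Finite Q] (hB : M.IsBireversible)
    (N : Set (M.stateGraph hM ≃g M.stateGraph hM)) (C : ℕ)
    (hN : ∀ g : M.wordGroup hM, ((fun k => k g) '' N).Finite ∧ ((fun k => k g) '' N).ncard ≤ C)
    (F : Set (M.wordGroup hM)) (hF : F.Finite)
    (hFN : ∀ k ∈ M.secGroup hM hB, (∀ v ∈ F, k v = v) → k ∈ N) :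
    Finite (M.wordGroup hM) := by
  -- A ball `B` that contains `F`; the restriction to `B` has finitely many values on `secGroup`.
  obtain ⟨n, hn⟩ : ∃ n, F ⊆ M.gens hM ^ n := by
    choose m hm using M.exists_mem_gens_pow hM
    obtain ⟨n, hn⟩ := (hF.image m).bddAbove
    exact ⟨n, fun v hv => Set.pow_subset_pow_right (M.one_mem_gens hM)
      (hn ⟨v, hv, rfl⟩) (hm v)⟩
  let B := M.gens hM ^ n
  have hBfin : Finite B := M.gens_pow_finite hM n
  let res : M.secGroup hM hB → B → B :=
    fun k v => ⟨k.1 v, M.secGroup_apply_mem_gens_pow hM hB k.2 n v.2⟩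
  have hres : ∀ k l : M.secGroup hM hB, res k = res l → (k⁻¹ * l).1 ∈ N := by
    intro k l hkl
    refine hFN _ (k⁻¹ * l).2 fun v hv => ?_
    have h : k.1 v = l.1 v := congrArg Subtype.val (congrFun hkl ⟨v, hn hv⟩)
    change k.1⁻¹ (l.1 v) = v
    rw [← h, RelIso.inv_apply_self]
  let R := Set.range res
  have : Fintype R := Fintype.ofFinite R
  have hout : ∀ ρ : R, ∃ k, res k = ρ := fun ρ => ρ.2
  choose out hout using hout
  refine M.finite_of_secGroup_orbits_bounded hM hB (Fintype.card R * C) fun g =>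
    ⟨⋃ ρ : R, (out ρ).1 '' ((fun k => k g) '' N), ?_, ?_, ?_⟩
  · exact Set.finite_iUnion fun ρ => (hN g).1.image _
  · refine (Set.ncard_iUnion_le_of_fintype _).trans ?_
    refine (Finset.sum_le_card_nsmul _ _ C fun ρ _ => ?_).trans (by simp)
    exact (Set.ncard_image_le (hN g).1).trans (hN g).2
  · intro k hk
    refine Set.mem_iUnion.2 ⟨⟨res ⟨k, hk⟩, ⟨_, rfl⟩⟩, ?_⟩
    set ρ : R := ⟨res ⟨k, hk⟩, ⟨_, rfl⟩⟩
    refine ⟨_, ⟨_, hres (out ρ) ⟨k, hk⟩ (hout ρ), rfl⟩, ?_⟩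
    exact RelIso.apply_inv_self (out ρ).1 (k g)

/-! ### The two non-discreteness properties -/

/-- If the group were discrete, only the identity would fix some finite set pointwise, and the
orbits of the trivial group have one element. -/
theorem not_discreteTopology_secGroup [Finite A] [Finite Q] [Infinite (M.wordGroup hM)]
    (hB : M.IsBireversible) : ¬ DiscreteTopology (M.secGroup hM hB) := by
  intro hd
  have h1 : ({1} : Set (M.secGroup hM hB)) ∈ nhds 1 := (isOpen_discrete _).mem_nhds rfl
  rw [nhds_subtype_eq_comap, Filter.mem_comap] at h1
  obtain ⟨U, hU, hU1⟩ := h1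
  obtain ⟨F, hF, hFU⟩ := exists_finite_fixing_subset_of_mem_nhds_one hU
  refine not_finite_iff_infinite.2 ‹_›
    (M.finite_of_fixing_subset hM hB {1} 1 (fun g => by simp) F hF fun k hk hkF => ?_)
  have h2 : (⟨k, hk⟩ : M.secGroup hM hB) ∈ ({1} : Set (M.secGroup hM hB)) := hU1 (hFU k hkF)
  exact congrArg Subtype.val h2

/-- A compact normal subgroup has orbits of bounded size because the graph is vertex-transitive,
and an open one contains the stabiliser of a finite set. -/
theorem not_isCompactByDiscrete [Finite A] [Finite Q] [Infinite (M.wordGroup hM)]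
    (hB : M.IsBireversible) : ¬ IsCompactByDiscrete (M.stateGraph hM ≃g M.stateGraph hM) := by
  rintro ⟨N, hnormal, hcompact, hdiscrete⟩
  obtain ⟨F, hF, hFN⟩ :=
    exists_finite_fixing_subset_of_mem_nhds_one N.mem_nhds_one_of_discreteTopology_quotient
  have hfin := finite_image_apply_of_isCompact hcompact (1 : M.wordGroup hM)
  have horb : ∀ g : M.wordGroup hM, (fun k : M.stateGraph hM ≃g M.stateGraph hM => k g) '' N ⊆
      (fun u => u * g) '' ((fun k : M.stateGraph hM ≃g M.stateGraph hM => k 1) '' N) := by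
    rintro g _ ⟨k, hk, rfl⟩
    -- The orbit of `g` is the translate of the orbit of `1` by the automorphism taking `1` to `g`.
    let r := rightMulHom (Set.range (M.state hM)) g
    refine ⟨_, ⟨r * k * r⁻¹, hnormal.conj_mem k hk r, rfl⟩, ?_⟩
    have h1 : r⁻¹ (1 : M.wordGroup hM) = g := by
      have h2 : r g = 1 := mul_inv_cancel g
      rw [← h2, RelIso.inv_apply_self]
    change k (r⁻¹ 1) * g⁻¹ * g = k g
    rw [h1, inv_mul_cancel_right]
  exact not_finite_iff_infinite.2 ‹_›
    (M.finite_of_fixing_subset hM hB N _ (fun g => ⟨(hfin.image _).subset (horb g),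
      (Set.ncard_le_ncard (horb g) (hfin.image _)).trans (Set.ncard_image_le hfin)⟩) F hF
      fun k _ hk => hFN k hk)

end MealyAutomaton

theorem mainTheorem6 {G : Type*} [Group G] [Infinite G] (hG : IsBireversibleGroup G) :
    ∃ (V : Type) (X : SimpleGraph V) (φ : G →* (X ≃g X)),
      X.Connected ∧
      (∀ v : V, (X.neighborSet v).Finite) ∧
      Function.Injective φ ∧
      IsGeometricAction X φ ∧
      (∃ (x : V) (K : Subgroup (X ≃g X)),
        K ≤ Subgroup.Commensurable.commensurator φ.range ⊓ MulAction.stabilizer (X ≃g X) x ∧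
        K.FG ∧
        ¬ DiscreteTopology K) ∧
      ¬ IsCompactByDiscrete (X ≃g X) := by
  obtain ⟨A, Q, _, _, M, hB, ⟨f⟩⟩ := hG
  have hM : M.IsInvertible := hB.1
  let e : G ≃* M.wordGroup hM :=
    f.trans (QuotientGroup.quotientKerEquivRange (M.freeGroupHom hM))
  have : Infinite (M.wordGroup hM) := Infinite.of_injective e e.injective
  have hQ : (Set.range (M.state hM)).Finite := Set.finite_range _
  have hrange : ((rightMulHom (Set.range (M.state hM))).comp e.toMonoidHom).range =
      (rightMulHom (Set.range (M.state hM))).range :=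
    SetLike.coe_injective (e.surjective.range_comp (rightMulHom (Set.range (M.state hM))))
  refine ⟨M.wordGroup hM, M.stateGraph hM, (rightMulHom _).comp e.toMonoidHom,
    leftCayley_connected _ (M.closure_range_state hM), leftCayley_neighborSet_finite _ hQ, ?_,
    isGeometricAction_rightMulHom _ hQ e, ⟨1, M.secGroup hM hB, ?_, ?_, ?_⟩,
    M.not_isCompactByDiscrete hM hB⟩
  · intro g h hgh
    have h1 : 1 * (e g)⁻¹ = 1 * (e h)⁻¹ := DFunLike.congr_fun hgh (1 : M.wordGroup hM)
    simpa using h1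
  · rw [hrange, MealyAutomaton.secGroup, Subgroup.closure_le]
    rintro _ ⟨a, rfl⟩
    exact ⟨M.secIso_mem_commensurator hM hB a, M.sec_one hM a⟩
  · exact (Subgroup.fg_iff _).2 ⟨_, rfl, Set.finite_range _⟩
  · exact M.not_discreteTopology_secGroup hM hB
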